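/- An identity $u\approx v$ is a pair of words over a countably infinite alphabet (elements of the free semigroup); a semigroup $S$ satisfies it if $u$ and $v$ take equal values under every assignment of elements of $S$ to the variables. A semigroup $S$ is finitely based if there is a finite set of identities of $S$ from which all identities of $S$ can be derived, and non-finitely based otherwise; monoids are regarded here as semigroups. For every integer $m\ge 4$, each of the following three Straubing monoids $S_{m+1}$ is non-finitely based: (1) the monoid, under composition, of all reflexive binary relations on a set with $m+1$ elements; (2) the monoid, under matrix multiplication, of all upper triangular $(m+1)\times(m+1)$ matrices with all diagonal entries equal to $1$ over the Boolean semiring $\{0,1\}$ (in which $1+1=1$); (3) the monoid, under composition, of all transformations $f$ of a chain with $m+1$ elements that are order preserving and extensive ($x\le f(x)$ for all $x$). -/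

import Mathlib

namespace Straubing

/-! ### Semigroup identities and the finite basis property -/

/-- Words: elements of the free semigroup over a countably infinite alphabet of variables. -/
abbrev Word : Type := FreeSemigroup ℕ

/-- The semigroup `S` satisfies the identity `u ≈ v`: the two words take the same value under
every assignment of elements of `S` to the variables. -/
def Satisfies (S : Type*) [Semigroup S] (u v : Word) : Prop :=
  ∀ f : ℕ → S, FreeSemigroup.lift f u = FreeSemigroup.lift f v

/-- `Derivable B u v`: the identity `u ≈ v` can be derived from the set of identities `B` by the
rules of equational logic for semigroups (substitution instances of members of `B`, closed under
reflexivity, symmetry, transitivity and multiplication). Equivalently, `(u, v)` lies in the least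
fully invariant congruence of the free semigroup that contains `B`. -/
inductive Derivable (B : Set (Word × Word)) : Word → Word → Prop
  | inst (u v : Word) (σ : ℕ → Word) (h : (u, v) ∈ B) :
      Derivable B (FreeSemigroup.lift σ u) (FreeSemigroup.lift σ v)
  | refl (u : Word) : Derivable B u u
  | symm {u v : Word} (h : Derivable B u v) : Derivable B v u
  | trans {u v w : Word} (h₁ : Derivable B u v) (h₂ : Derivable B v w) : Derivable B u w
  | mul {u v u' v' : Word} (h₁ : Derivable B u v) (h₂ : Derivable B u' v') :
      Derivable B (u * u') (v * v')

/-- A semigroup is finitely based if there is a finite set of its identities from which all of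
its identities can be derived. -/
def FinitelyBased (S : Type*) [Semigroup S] : Prop :=
  ∃ B : Set (Word × Word), B.Finite ∧ (∀ p ∈ B, Satisfies S p.1 p.2) ∧
    ∀ u v : Word, Satisfies S u v → Derivable B u v

/-! ### Reflexive binary relations -/

/-- The reflexive binary relations on `X`. -/
def ReflexiveRel (X : Type*) : Type _ := {R : SetRel X X // ∀ x : X, (x, x) ∈ R}

/-- Reflexive relations form a monoid under composition of relations. -/
instance ReflexiveRel.instMonoid (X : Type*) : Monoid (ReflexiveRel X) where
  mul R S := ⟨R.1.comp S.1, fun x => ⟨x, R.2 x, S.2 x⟩⟩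
  one := ⟨SetRel.id, fun _ => rfl⟩
  mul_assoc R S T := Subtype.ext (SetRel.comp_assoc R.1 S.1 T.1)
  one_mul R := Subtype.ext (SetRel.id_comp R.1)
  mul_one R := Subtype.ext (SetRel.comp_id R.1)

/-! ### Unitriangular matrices over the Boolean semiring -/

/-- The underlying set of the Boolean semiring. A separate name is needed because the addition
that `Bool` carries in Mathlib is exclusive or. -/
def BooleanSemiring : Type := Bool

instance BooleanSemiring.instZero : Zero BooleanSemiring := ⟨false⟩

instance BooleanSemiring.instAdd : Add BooleanSemiring := ⟨or⟩

/-- The Boolean semiring `{0, 1}`: addition is disjunction (so `1 + 1 = 1`) and multiplication is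
conjunction. -/
instance BooleanSemiring.instCommSemiring : CommSemiring BooleanSemiring where
  one := true
  mul := and
  add_assoc := Bool.or_assoc
  zero_add := Bool.false_or
  add_zero := Bool.or_false
  add_comm := Bool.or_comm
  mul_assoc := Bool.and_assoc
  one_mul := Bool.true_and
  mul_one := Bool.and_true
  zero_mul := Bool.false_and
  mul_zero := Bool.and_false
  mul_comm := Bool.and_comm
  left_distrib := Bool.and_or_distrib_left
  right_distrib := Bool.and_or_distrib_right
  nsmul := nsmulRec

/-- The monoid of all upper triangular `n × n` matrices over the Boolean semiring with all
diagonal entries equal to `1`. -/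
def unitriangular (n : ℕ) : Submonoid (Matrix (Fin n) (Fin n) BooleanSemiring) where
  carrier := {A | A.BlockTriangular id ∧ ∀ i, A i i = 1}
  one_mem' := ⟨Matrix.blockTriangular_one, fun i => Matrix.one_apply_eq i⟩
  mul_mem' := by
    rintro A B ⟨hA, hA1⟩ ⟨hB, hB1⟩
    refine ⟨hA.mul hB, fun i => ?_⟩
    rw [Matrix.mul_apply, Finset.sum_eq_single i]
    · rw [hA1, hB1, one_mul]
    · intro j _ hj
      rcases lt_or_gt_of_ne hj with h | h
      · rw [hA h, zero_mul]
      · rw [hB h, mul_zero]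
    · intro h
      exact absurd (Finset.mem_univ i) h

/-! ### Order preserving extensive transformations -/

/-- The monoid, under composition, of all order preserving and extensive (`x ≤ f x` for all `x`)
transformations of a chain. -/
def extensiveMaps (C : Type*) [LinearOrder C] : Submonoid (C →o C) where
  carrier := {f | ∀ x, x ≤ f x}
  one_mem' := fun x => le_refl x
  mul_mem' := fun {_ g} hf hg x => (hg x).trans (hf (g x))

end Straubing

namespace Straubing

/-! In all three monoids the identities are exactly the pairs of words with the same scattered
subwords of length at most `m`. A product of reflexive relations on `m + 1` points relates two
points through a path whose loops can be cut out, so only subwords of length at most `m` matter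
(`exists_short_sublist`). Extensive maps of `Fin (m + 1)` embed into unitriangular Boolean matrices,
which embed into reflexive relations, and already the extensive maps detect every subword of length
at most `m` (`stepMap_prod_le_iff`).

Such an equational theory has no finite basis when `m = k + 3` with `k > 0`. With `z i`, `t i` the
block and linear letters, the words `stem n ++ 0 :: 1 :: cycleWord k` and `stem n ++ 1 :: 0 ::
cycleWord k` are `m`-equivalent, but only the second contains the subwords `t i, z i, 1, 0, 2, ...,
2` of length `m + 1`. Avoiding all of these is preserved by every identity of the theory with fewer
than about `n` letters on each side: by pigeonhole some `z i` preceded by `t i` lies in the image of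
a letter occurring once in the identity, and `m`-equivalence then controls everything to its right
(`not_sublist_flatMap_of_simonEquiv`). -/

/-- The list of letters of a word. -/
def letters (u : Word) : List ℕ := u.head :: u.tail

theorem letters_mul (u v : Word) : letters (u * v) = letters u ++ letters v := rfl

theorem letters_lift (σ : ℕ → Word) (u : Word) :
    letters (FreeSemigroup.lift σ u) = (letters u).flatMap fun i => letters (σ i) := by
  induction u using FreeSemigroup.recOnMul with
  | ih1 x => simp [letters]
  | ih2 x y h₁ h₂ =>
    rw [map_mul, letters_mul, letters_mul, List.flatMap_append, h₂, FreeSemigroup.lift_of]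
    simp [letters]

theorem lift_eq_prod {M : Type*} [Monoid M] (f : ℕ → M) (u : Word) :
    FreeSemigroup.lift f u = ((letters u).map f).prod := by
  induction u using FreeSemigroup.recOnMul with
  | ih1 x => simp [letters]
  | ih2 x y h₁ h₂ =>
    rw [map_mul, letters_mul, List.map_append, List.prod_append, h₂, FreeSemigroup.lift_of]
    simp [letters]

/-! ### Simon's congruence and substitutions -/

/-- Simon's congruence: the two lists have the same scattered subwords of length at most `m`. -/
def SimonEquiv {α : Type*} (m : ℕ) (a b : List α) : Prop :=
  ∀ w : List α, w.length ≤ m → (w.Sublist a ↔ w.Sublist b)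

namespace SimonEquiv

variable {α β : Type*} {m : ℕ} {a b c d : List α}

theorem refl (a : List α) : SimonEquiv m a a := fun _ _ => Iff.rfl

theorem symm (h : SimonEquiv m a b) : SimonEquiv m b a := fun w hw => (h w hw).symm

theorem trans (h : SimonEquiv m a b) (h' : SimonEquiv m b c) : SimonEquiv m a c :=
  fun w hw => (h w hw).trans (h' w hw)

theorem append (h : SimonEquiv m a b) (h' : SimonEquiv m c d) :
    SimonEquiv m (a ++ c) (b ++ d) := by
  intro w hw
  simp only [List.sublist_append_iff]
  constructor <;> rintro ⟨w₁, w₂, rfl, h₁, h₂⟩ <;> rw [List.length_append] at hw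
  · exact ⟨w₁, w₂, rfl, (h _ (by omega)).1 h₁, (h' _ (by omega)).1 h₂⟩
  · exact ⟨w₁, w₂, rfl, (h _ (by omega)).2 h₁, (h' _ (by omega)).2 h₂⟩

end SimonEquiv

/-- An embedding of `w` meets at most `w.length` blocks; keep only those. This is what makes Simon's
congruence invariant under substitution. -/
theorem exists_sublist_of_sublist_flatMap {α β : Type*} (Θ : α → List β) {b : List α} :
    ∀ {w : List β}, w.Sublist (b.flatMap Θ) →
      ∃ c : List α, c.Sublist b ∧ c.length ≤ w.length ∧ w.Sublist (c.flatMap Θ) := by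
  induction b with
  | nil => intro w h; exact ⟨[], by simp, by simp, h⟩
  | cons s b ih =>
    intro w h
    rw [List.flatMap_cons, List.sublist_append_iff] at h
    obtain ⟨w₁, w₂, rfl, h₁, h₂⟩ := h
    obtain ⟨c, hc, hl, hw⟩ := ih h₂
    cases w₁ with
    | nil => exact ⟨c, hc.cons s, by simpa using hl, hw⟩
    | cons x w₁ =>
      refine ⟨s :: c, hc.cons_cons s, by simp; omega, ?_⟩
      rw [List.flatMap_cons]
      exact h₁.append hw

theorem flatMap_sublist_flatMap {α β : Type*} (Θ : α → List β) {c b : List α}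
    (h : c.Sublist b) : (c.flatMap Θ).Sublist (b.flatMap Θ) := by
  induction h with
  | slnil => simp
  | cons s _ ih => rw [List.flatMap_cons]; exact ih.trans (List.sublist_append_right _ _)
  | cons_cons s _ ih => simp only [List.flatMap_cons]; exact (List.Sublist.refl _).append ih

theorem SimonEquiv.flatMap {α β : Type*} {m : ℕ} {a b : List α} (h : SimonEquiv m a b)
    (Θ : α → List β) : SimonEquiv m (a.flatMap Θ) (b.flatMap Θ) := by
  intro w hw
  constructor <;> intro h' <;> obtain ⟨c, hc, hl, hw'⟩ := exists_sublist_of_sublist_flatMap Θ h'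
  · exact hw'.trans (flatMap_sublist_flatMap Θ ((h c (hl.trans hw)).1 hc))
  · exact hw'.trans (flatMap_sublist_flatMap Θ ((h c (hl.trans hw)).2 hc))

theorem mem_sublist_append_of_mem {α : Type*} {c : α} {w l₁ l₂ : List α} (hc : c ∈ l₁)
    (hw : w.Sublist l₂) : (c :: w).Sublist (l₁ ++ l₂) :=
  (List.singleton_sublist.2 hc).append hw

/-- Embeddings may be taken leftmost, so `c` can be matched with its first occurrence. -/
theorem cons_sublist_append_cons_iff {α : Type*} {c : α} {w l₁ l₂ : List α} (hc : c ∉ l₁) :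
    (c :: w).Sublist (l₁ ++ c :: l₂) ↔ w.Sublist l₂ := by
  constructor
  · intro h
    obtain ⟨w₁, w₂, h₁, h₂, h₃⟩ := List.sublist_append_iff.1 h
    cases w₁ with
    | nil => simp only [List.nil_append] at h₁; subst h₁; exact List.cons_sublist_cons.1 h₃
    | cons d w₁ =>
      rw [List.cons_append, List.cons.injEq] at h₁
      exact absurd (h₂.subset (by simp [h₁.1])) hc
  · intro h
    exact (h.cons_cons c).trans (List.sublist_append_right _ _)

/-! ### Substituted letters that occur once -/

theorem exists_split_of_pair_sublist_flatMap {α β : Type*} {Θ : α → List β} {a : List α} {t z : β}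
    (h : [t, z].Sublist (a.flatMap Θ)) :
    ∃ a₁ s a₂ g r, a = a₁ ++ s :: a₂ ∧ Θ s = g ++ z :: r ∧ t ∈ a₁.flatMap Θ ++ g := by
  induction a with
  | nil => simp at h
  | cons s a ih =>
    rw [List.flatMap_cons, List.sublist_append_iff] at h
    obtain ⟨w₁, w₂, h₁, h₂, h₃⟩ := h
    match w₁, h₁ with
    | [], h₁ =>
      simp only [List.nil_append] at h₁
      subst h₁
      obtain ⟨a₁, s', a₂, g, r, rfl, h₅, h₆⟩ := ih h₃
      exact ⟨s :: a₁, s', a₂, g, r, rfl, h₅, by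
        rw [List.flatMap_cons, List.append_assoc]; exact List.mem_append_right _ h₆⟩
    | [t'], h₁ =>
      simp only [List.cons_append, List.nil_append, List.cons.injEq] at h₁
      obtain ⟨rfl, rfl⟩ := h₁
      have hz : z ∈ a.flatMap Θ := List.singleton_sublist.1 h₃
      obtain ⟨s', hs', hz'⟩ := List.mem_flatMap.1 hz
      obtain ⟨a₁, a₂, rfl⟩ := List.append_of_mem hs'
      obtain ⟨g, r, hgr⟩ := List.append_of_mem hz'
      refine ⟨s :: a₁, s', a₂, g, r, rfl, hgr, ?_⟩
      rw [List.flatMap_cons, List.append_assoc]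
      exact List.mem_append_left _ (List.singleton_sublist.1 h₂)
    | t' :: z' :: w₁, h₁ =>
      simp only [List.cons_append, List.cons.injEq] at h₁
      obtain ⟨rfl, rfl, h₁⟩ := h₁
      obtain ⟨rfl, rfl⟩ := List.append_eq_nil_iff.1 h₁.symm
      obtain ⟨g, r, hgr, h₄, h₅⟩ := List.cons_sublist_iff.1 h₂
      obtain ⟨r₁, r₂, rfl⟩ := List.append_of_mem (List.singleton_sublist.1 h₅)
      exact ⟨[], s, a, g ++ r₁, r₂, rfl, by simp [hgr], by simp [h₄]⟩

theorem SimonEquiv.sublist_of_unique {α : Type*} {m : ℕ} {a₁ a₂ b₁ b₂ : List α} {s : α}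
    (h : SimonEquiv m (a₁ ++ s :: a₂) (b₁ ++ s :: b₂)) (hs : s ∉ a₁) {c : List α}
    (hc : c.length < m) (hcb : c.Sublist b₂) : c.Sublist a₂ :=
  (cons_sublist_append_cons_iff hs).1 <|
    (h (s :: c) hc).2 ((hcb.cons_cons s).trans (List.sublist_append_right _ _))

theorem exists_linear_block {α β : Type*} {a : List α} {Θ : α → List β} {n : ℕ} {z t : ℕ → β}
    (htz : ∀ i < n, [t i, z i].Sublist (a.flatMap Θ))
    (htt : ∀ i < n, ¬ [t i, t i].Sublist (a.flatMap Θ))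
    (htzz : ∀ i < n, ¬ [t i, z i, z i].Sublist (a.flatMap Θ))
    (hzzt : ∀ i < n, ¬ [z i, z i, t i].Sublist (a.flatMap Θ))
    (hztz : ∀ i j, i < j → j < n → ¬ [z j, t i, z j].Sublist (a.flatMap Θ))
    (hn : a.length < n) :
    ∃ i < n, ∃ a₁ s a₂ g r, a = a₁ ++ s :: a₂ ∧ Θ s = g ++ z i :: r ∧
      t i ∈ a₁.flatMap Θ ++ g ∧ s ∉ a₁ ∧ s ∉ a₂ := by
  have key : ∀ i : Fin n, ∃ a₁ s a₂ g r, a = a₁ ++ s :: a₂ ∧ Θ s = g ++ z i :: r ∧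
      t i ∈ a₁.flatMap Θ ++ g := fun i => exists_split_of_pair_sublist_flatMap (htz i i.2)
  choose a₁ s a₂ g r ha hs ht using key
  -- There are more indices than positions in `a`, so two of the chosen `z i`, `z j` lie in the
  -- image of the same position.
  obtain ⟨i, j, hij, h⟩ : ∃ i j : Fin n, i < j ∧ (a₁ i).length = (a₁ j).length := by
    have hlt : ∀ i, (a₁ i).length < a.length := fun i => by
      conv_rhs => rw [ha i]
      simp
    obtain ⟨i, j, hne, h⟩ := Fintype.exists_ne_map_eq_of_card_lt
      (fun i : Fin n => (⟨(a₁ i).length, hlt i⟩ : Fin a.length)) (by simpa using hn)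
    rw [Fin.mk.injEq] at h
    rcases lt_or_gt_of_ne hne with h' | h'
    exacts [⟨i, j, h', h⟩, ⟨j, i, h', h.symm⟩]
  have hss : s i = s j := by
    have := (List.append_inj ((ha i).symm.trans (ha j)) h).2
    exact (List.cons.inj this).1
  have hzi : z i ∈ Θ (s i) := by simp [hs i]
  have hzj : z j ∈ Θ (s i) := by simp [hss, hs j]
  -- With two occurrences of `s i`, each of whose images contains `z i` and `z j`, any place for `t
  -- i` gives a forbidden pattern: before both, inside one, between them, or after both.
  have twice : ∀ c₁ c₂ c₃, a ≠ c₁ ++ s i :: c₂ ++ s i :: c₃ := by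
    intro c₁ c₂ c₃ hc
    have hA : a.flatMap Θ = c₁.flatMap Θ ++ (Θ (s i) ++ (c₂.flatMap Θ ++
        (Θ (s i) ++ c₃.flatMap Θ))) := by simp [hc]
    have htA : t i ∈ a.flatMap Θ := (htz i i.2).subset (by simp)
    have e := List.nil_sublist (c₃.flatMap Θ)
    rw [hA] at htA
    simp only [List.mem_append] at htA
    have skip : ∀ {w l₁ l₂ : List β}, w.Sublist l₂ → w.Sublist (l₁ ++ l₂) :=
      fun h => h.trans (List.sublist_append_right _ _)
    rcases htA with h | h | h | h | h
    · exact htzz i i.2 (hA ▸ mem_sublist_append_of_mem h (mem_sublist_append_of_mem hzi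
        (skip (mem_sublist_append_of_mem hzi e))))
    · exact htt i i.2 (hA ▸ skip (mem_sublist_append_of_mem h
        (skip (mem_sublist_append_of_mem h e))))
    · exact hztz i j hij j.2 (hA ▸ skip (mem_sublist_append_of_mem hzj
        (mem_sublist_append_of_mem h (mem_sublist_append_of_mem hzj e))))
    · exact htt i i.2 (hA ▸ skip (mem_sublist_append_of_mem h
        (skip (mem_sublist_append_of_mem h e))))
    · exact hzzt i i.2 (hA ▸ skip (mem_sublist_append_of_mem hzi
        (skip (mem_sublist_append_of_mem hzi (List.singleton_sublist.2 h)))))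
  refine ⟨i, i.2, a₁ i, s i, a₂ i, g i, r i, ha i, hs i, ht i, fun h => ?_, fun h => ?_⟩
  · obtain ⟨c₁, c₂, hc⟩ := List.append_of_mem h
    exact twice c₁ c₂ (a₂ i) (by rw [← hc]; exact ha i)
  · obtain ⟨c₁, c₂, hc⟩ := List.append_of_mem h
    exact twice (a₁ i) c₁ c₂ (by rw [List.append_assoc, List.cons_append, ← hc]; exact ha i)

/-- Cut both images at a `z i` inside `Θ s`, where `s` occurs once in `a`. A bad subword on the `b`
side must have `y :: w` to the right of the cut. The part of it beyond `Θ s` needs fewer than `m`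
letters of `b₂`, and these also embed in `a₂`. Since `t i` precedes the cut in the image of `a`, a
bad subword with index `i` appears there. -/
theorem not_sublist_flatMap_of_simonEquiv {α β : Type*} {a b : List α} {Θ : α → List β}
    {m n : ℕ} {z t : ℕ → β} {y : β} {w : List β} (hy : ∀ i, y ≠ z i) (hm : 4 ≤ m)
    (hw : w.length + 2 ≤ m) (hab : SimonEquiv m a b)
    (htz : ∀ i < n, [t i, z i].Sublist (a.flatMap Θ))
    (htt : ∀ i < n, ¬ [t i, t i].Sublist (a.flatMap Θ))
    (htzz : ∀ i < n, ¬ [t i, z i, z i].Sublist (a.flatMap Θ))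
    (hzzt : ∀ i < n, ¬ [z i, z i, t i].Sublist (a.flatMap Θ))
    (hztz : ∀ i j, i < j → j < n → ¬ [z j, t i, z j].Sublist (a.flatMap Θ))
    (htzyz : ∀ i j, i < n → j < n → ¬ [t j, z j, y, z i].Sublist (a.flatMap Θ))
    (hn : a.length < n) (ha : ∀ i < n, ¬ (t i :: z i :: y :: w).Sublist (a.flatMap Θ)) :
    ∀ i < n, ¬ (t i :: z i :: y :: w).Sublist (b.flatMap Θ) := by
  intro j hj hjw
  obtain ⟨i, hi, a₁, s, a₂, g, r, rfl, hs, ht, hs₁, hs₂⟩ :=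
    exists_linear_block htz htt htzz hzzt hztz hn
  obtain ⟨b₁, b₂, rfl⟩ := List.append_of_mem <| List.singleton_sublist.1 <|
    (hab [s] (by simp; omega)).1 (List.singleton_sublist.2 (by simp))
  have hA : (a₁ ++ s :: a₂).flatMap Θ = (a₁.flatMap Θ ++ g) ++ z i :: (r ++ a₂.flatMap Θ) := by
    simp [hs]
  have hB : (b₁ ++ s :: b₂).flatMap Θ = (b₁.flatMap Θ ++ g) ++ z i :: (r ++ b₂.flatMap Θ) := by
    simp [hs]
  have hywb : (y :: w).Sublist (r ++ b₂.flatMap Θ) := by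
    rw [hB] at hjw
    obtain ⟨w₁, w₂, h₁, h₂, h₃⟩ := List.sublist_append_iff.1 hjw
    have tail : ∀ {l : List β}, (l ++ y :: w).Sublist (z i :: (r ++ b₂.flatMap Θ)) →
        (y :: w).Sublist (r ++ b₂.flatMap Θ) := by
      intro l hl
      rcases List.sublist_cons_iff.1 ((List.sublist_append_right l _).trans hl) with h | ⟨_, h, _⟩
      · exact h
      · exact absurd (List.cons.inj h).1 (hy i)
    match w₁, h₁ with
    | [], h₁ =>
      simp only [List.nil_append] at h₁
      subst h₁
      exact tail (l := [t j, z j]) h₃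
    | [_], h₁ =>
      simp only [List.cons_append, List.nil_append, List.cons.injEq] at h₁
      obtain ⟨rfl, rfl⟩ := h₁
      exact tail (l := [z j]) h₃
    | [_, _], h₁ =>
      simp only [List.cons_append, List.nil_append, List.cons.injEq] at h₁
      obtain ⟨rfl, rfl, rfl⟩ := h₁
      exact tail (l := []) h₃
    | x₁ :: x₂ :: x₃ :: w₁, h₁ =>
      simp only [List.cons_append, List.cons.injEq] at h₁
      obtain ⟨rfl, rfl, rfl, -⟩ := h₁
      -- Here `t j, z j, y` all lie left of the cut, so together with `z i` they form a forbidden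
      -- pattern of length `4 ≤ m`, which transfers to the image of `a`.
      refine absurd (((hab.flatMap Θ) [t j, z j, y, z i] (by simpa using hm)).2 ?_)
        (htzyz i j hi hj)
      rw [hB]
      have h₄ : [t j, z j, y].Sublist (t j :: z j :: y :: w₁) := by simp
      have h₅ : [z i].Sublist (z i :: (r ++ b₂.flatMap Θ)) := by simp
      exact (h₄.trans h₂).append h₅
  obtain ⟨w₁, w₂, h₁, h₂, h₃⟩ := List.sublist_append_iff.1 hywb
  obtain ⟨c, hc, hcl, hwc⟩ := exists_sublist_of_sublist_flatMap Θ h₃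
  have hlen := congrArg List.length h₁
  simp only [List.length_cons, List.length_append] at hlen
  have hca : c.Sublist a₂ := hab.sublist_of_unique hs₁ (by omega) hc
  refine ha i hi ?_
  rw [hA, h₁]
  exact mem_sublist_append_of_mem ht
    ((h₂.append (hwc.trans (flatMap_sublist_flatMap Θ hca))).cons_cons _)

/-! ### Derivations and syntactic equivalence -/

/-- Membership in the set of lists `l` with `P l` is unaffected by replacing the factor `a`
by `b`. -/
def SyntacticEquiv {α : Type*} (P : List α → Prop) (a b : List α) : Prop :=
  ∀ c d : List α, P (c ++ a ++ d) ↔ P (c ++ b ++ d)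

theorem Derivable.syntacticEquiv {B : Set (Word × Word)} {P : List ℕ → Prop}
    (hB : ∀ p ∈ B, ∀ σ : ℕ → Word, SyntacticEquiv P (letters (FreeSemigroup.lift σ p.1))
      (letters (FreeSemigroup.lift σ p.2))) {u v : Word} (h : Derivable B u v) :
    SyntacticEquiv P (letters u) (letters v) := by
  induction h with
  | inst u v σ h => exact hB _ h σ
  | refl u => exact fun _ _ => Iff.rfl
  | symm _ ih => exact fun c d => (ih c d).symm
  | trans _ _ ih₁ ih₂ => exact fun c d => (ih₁ c d).trans (ih₂ c d)
  | @mul u v u' v' _ _ ih₁ ih₂ =>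
    intro c d
    have h₁ := ih₁ c (letters u' ++ d)
    have h₂ := ih₂ (c ++ letters v) d
    simp only [letters_mul, List.append_assoc] at h₁ h₂ ⊢
    exact h₁.trans h₂

/-! ### The critical words and their short subwords -/

/-- The letters repeated in the critical words. -/
def blockLetter (i : ℕ) : ℕ := 2 * i + 3

/-- The letters that occur once in the critical words. -/
def linearLetter (i : ℕ) : ℕ := 2 * i + 4

/-- The alternation of block letters and linear letters with indices from a list. -/
def alternation (I : List ℕ) : List ℕ := I.flatMap fun i => [blockLetter i, linearLetter i]

/-- The word `(2 0 1)^k`. -/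
def cycleWord : ℕ → List ℕ
  | 0 => []
  | k + 1 => 2 :: 0 :: 1 :: cycleWord k

/-- The common prefix of the critical words. -/
def stem (n : ℕ) : List ℕ :=
  0 :: 1 :: (alternation (List.range n) ++ 0 :: 1 :: (List.range n).map blockLetter)

theorem exists_range_eq_append {i n : ℕ} (h : i < n) :
    ∃ R : List ℕ, List.range n = List.range i ++ i :: R ∧ ∀ j ∈ R, i < j := by
  obtain ⟨k, rfl⟩ := Nat.exists_eq_add_of_lt h
  refine ⟨(List.range k).map (i + 1 + ·), ?_, fun j hj => ?_⟩
  · rw [show i + k + 1 = i + 1 + k by omega, List.range_add, List.range_succ]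
    simp
  · obtain ⟨l, -, rfl⟩ := List.mem_map.1 hj
    omega

theorem mem_alternation {I : List ℕ} {c : ℕ} :
    c ∈ alternation I ↔ ∃ i ∈ I, c = blockLetter i ∨ c = linearLetter i := by
  simp [alternation]

section stem

variable {n i : ℕ} {E : List ℕ}

theorem exists_stem_append_eq (h : i < n) (E : List ℕ) : ∃ R : List ℕ, (∀ j ∈ R, i < j) ∧
    stem n ++ E = (0 :: 1 :: alternation (List.range i)) ++ blockLetter i :: linearLetter i ::
      (alternation R ++ 0 :: 1 :: (List.range i).map blockLetter ++
        blockLetter i :: (R.map blockLetter ++ E)) := by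
  obtain ⟨R, hR, hlt⟩ := exists_range_eq_append h
  exact ⟨R, hlt, by simp [stem, hR, alternation]⟩

/-- Leftmost matching of an initial `z i`, `t i` or `t i, z i` reduces each pattern question to a
membership check in an explicit remainder. -/
theorem exists_stem_append_sublist_iff (h : i < n) (E : List ℕ) :
    ∃ R : List ℕ, (∀ j ∈ R, i < j) ∧
      (∀ w : List ℕ, (blockLetter i :: w).Sublist (stem n ++ E) ↔
        w.Sublist (linearLetter i :: (alternation R ++
          0 :: 1 :: (List.range i).map blockLetter ++
          blockLetter i :: (R.map blockLetter ++ E)))) ∧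
      (∀ w : List ℕ, (linearLetter i :: w).Sublist (stem n ++ E) ↔
        w.Sublist (alternation R ++ 0 :: 1 :: (List.range i).map blockLetter ++
          blockLetter i :: (R.map blockLetter ++ E))) ∧
      ∀ w : List ℕ, (linearLetter i :: blockLetter i :: w).Sublist (stem n ++ E) ↔
        w.Sublist (R.map blockLetter ++ E) := by
  obtain ⟨R, hR, hE⟩ := exists_stem_append_eq h E
  have hlin : ∀ w : List ℕ, (linearLetter i :: w).Sublist (stem n ++ E) ↔
      w.Sublist (alternation R ++ 0 :: 1 :: (List.range i).map blockLetter ++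
        blockLetter i :: (R.map blockLetter ++ E)) := by
    intro w
    rw [hE, List.append_cons, cons_sublist_append_cons_iff]
    simp only [List.mem_append, List.mem_cons, mem_alternation, List.mem_range, blockLetter,
      linearLetter, List.not_mem_nil, or_false]
    rintro ((h | h | ⟨j, hj, h | h⟩) | h) <;> omega
  refine ⟨R, hR, fun w => ?_, hlin, fun w => ?_⟩
  · rw [hE, cons_sublist_append_cons_iff]
    simp only [List.mem_cons, mem_alternation, List.mem_range, blockLetter, linearLetter]
    rintro (h | h | ⟨j, hj, h | h⟩) <;> omega
  · rw [hlin, cons_sublist_append_cons_iff]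
    simp only [List.mem_append, List.mem_cons, mem_alternation, List.mem_map,
      List.mem_range, blockLetter, linearLetter]
    rintro (⟨j, hj, h | h⟩ | h | h | ⟨j, hj, h⟩)
    · have := hR j hj; omega
    all_goals omega

theorem linear_block_sublist (h : i < n) :
    [linearLetter i, blockLetter i].Sublist (stem n ++ E) := by
  obtain ⟨R, -, -, -, h⟩ := exists_stem_append_sublist_iff h E
  simp [h]

theorem not_linear_linear_sublist (hE : ∀ c ∈ E, c < 3) (h : i < n) :
    ¬ [linearLetter i, linearLetter i].Sublist (stem n ++ E) := by
  obtain ⟨R, hR, -, h, -⟩ := exists_stem_append_sublist_iff h E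
  rw [h, List.singleton_sublist]
  simp only [List.mem_append, List.mem_cons, mem_alternation, List.mem_map,
    List.mem_range, blockLetter, linearLetter]
  rintro ((⟨j, hj, h | h⟩ | h | h | ⟨j, hj, h⟩) | h | ⟨j, hj, h⟩ | h)
  · omega
  · have := hR j hj; omega
  iterate 5 omega
  · have := hE _ h; omega

theorem not_linear_block_block_sublist (hE : ∀ c ∈ E, c < 3) (h : i < n) :
    ¬ [linearLetter i, blockLetter i, blockLetter i].Sublist (stem n ++ E) := by
  obtain ⟨R, hR, -, -, h⟩ := exists_stem_append_sublist_iff h E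
  rw [h, List.singleton_sublist]
  simp only [List.mem_append, List.mem_map, blockLetter]
  rintro (⟨j, hj, h⟩ | h)
  · have := hR j hj; omega
  · have := hE _ h; omega

theorem not_block_block_linear_sublist (hE : ∀ c ∈ E, c < 3) (h : i < n) :
    ¬ [blockLetter i, blockLetter i, linearLetter i].Sublist (stem n ++ E) := by
  obtain ⟨R, hR, h, -, -⟩ := exists_stem_append_sublist_iff h E
  rw [h, ← List.cons_append, cons_sublist_append_cons_iff, List.singleton_sublist]
  · simp only [List.mem_append, List.mem_map, blockLetter, linearLetter]
    rintro (⟨j, hj, h⟩ | h)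
    · omega
    · have := hE _ h; omega
  · simp only [List.mem_append, List.mem_cons, mem_alternation, List.mem_map,
      List.mem_range, blockLetter, linearLetter]
    rintro (h | ⟨j, hj, h | h⟩ | h | h | ⟨j, hj, h⟩)
    · omega
    · have := hR j hj; omega
    all_goals omega

/-- For `i < j` the only `t i` stands before the first `z j`. -/
theorem not_block_linear_block_sublist (hE : ∀ c ∈ E, c < 3) {j : ℕ} (hij : i < j) (h : j < n) :
    ¬ [blockLetter j, linearLetter i, blockLetter j].Sublist (stem n ++ E) := by
  obtain ⟨R, hR, h, -, -⟩ := exists_stem_append_sublist_iff h E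
  rw [h]
  intro hs
  have hmem := hs.subset (List.mem_cons_self)
  revert hmem
  simp only [List.mem_append, List.mem_cons, mem_alternation, List.mem_map,
    List.mem_range, blockLetter, linearLetter]
  rintro (h | (⟨k, hk, h | h⟩ | h | h | ⟨k, hk, h⟩) | h | ⟨k, hk, h⟩ | h)
  · omega
  · omega
  · have := hR k hk; omega
  iterate 5 omega
  · have := hE _ h; omega

/-- After `t j, z j` only block letters remain before `E`, so the `1` must come from `E`, where no
block letter follows. -/
theorem not_linear_block_one_block_sublist (hE : ∀ c ∈ E, c < 3) {j : ℕ} (h : j < n) :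
    ¬ [linearLetter j, blockLetter j, 1, blockLetter i].Sublist (stem n ++ E) := by
  obtain ⟨R, hR, -, -, h⟩ := exists_stem_append_sublist_iff h E
  rw [h]
  intro hs
  obtain ⟨w₁, w₂, h₁, h₂, h₃⟩ := List.sublist_append_iff.1 hs
  cases w₁ with
  | nil =>
    simp only [List.nil_append] at h₁
    subst h₁
    have := hE (blockLetter i) (h₃.subset (by simp))
    simp only [blockLetter] at this
    omega
  | cons c w₁ =>
    rw [List.cons_append, List.cons.injEq] at h₁
    obtain ⟨k, -, hk⟩ := List.mem_map.1 (h₂.subset List.mem_cons_self)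
    rw [← h₁.1] at hk
    simp only [blockLetter] at hk
    omega

end stem

section cycleWord

theorem count_cycleWord (k : ℕ) : (cycleWord k).count 2 = k := by
  induction k with
  | zero => rfl
  | succ k ih => simp [cycleWord, ih]

theorem replicate_sublist_cycleWord (k : ℕ) : (List.replicate k 2).Sublist (cycleWord k) :=
  List.replicate_sublist_iff.2 (count_cycleWord k).ge

theorem lt_of_mem_cycleWord {k c : ℕ} (h : c ∈ cycleWord k) : c < 3 := by
  induction k with
  | zero => simp [cycleWord] at h
  | succ k ih =>
    simp only [cycleWord, List.mem_cons] at h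
    rcases h with rfl | rfl | rfl | h
    exacts [by omega, by omega, by omega, ih h]

/-- Each period contains all three letters, so one period per letter of `w` suffices. -/
theorem sublist_cycleWord {k : ℕ} {w : List ℕ} (hw : ∀ c ∈ w, c < 3) (hk : w.length ≤ k) :
    w.Sublist (cycleWord k) := by
  induction k generalizing w with
  | zero => rw [List.eq_nil_of_length_eq_zero (Nat.le_zero.1 hk)]; exact List.nil_sublist _
  | succ k ih =>
    cases w with
    | nil => exact List.nil_sublist _
    | cons c w =>
      have hc := hw c List.mem_cons_self
      refine mem_sublist_append_of_mem (l₁ := [2, 0, 1]) ?_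
        (ih (fun d hd => hw d (List.mem_cons_of_mem _ hd)) (by simpa using hk))
      simp only [List.mem_cons, List.not_mem_nil]
      omega

theorem not_critical_sublist {n i k : ℕ} (h : i < n) (hk : 0 < k) :
    ¬ (linearLetter i :: blockLetter i :: 1 :: 0 :: List.replicate k 2).Sublist
      (stem n ++ 0 :: 1 :: cycleWord k) := by
  obtain ⟨R, hR, -, -, h⟩ := exists_stem_append_sublist_iff h (0 :: 1 :: cycleWord k)
  obtain ⟨k, rfl⟩ := Nat.exists_eq_add_one.2 hk
  rw [h, List.append_cons, cons_sublist_append_cons_iff, cycleWord]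
  · change ¬ (0 :: List.replicate (k + 1) 2).Sublist ([2] ++ 0 :: 1 :: cycleWord k)
    rw [cons_sublist_append_cons_iff (by simp), List.replicate_sublist_iff]
    simp [count_cycleWord]
  · simp only [List.mem_append, List.mem_map, blockLetter, List.mem_singleton]
    rintro (⟨j, -, h⟩ | h) <;> omega

theorem critical_sublist {n i : ℕ} (k : ℕ) (h : i < n) :
    (linearLetter i :: blockLetter i :: 1 :: 0 :: List.replicate k 2).Sublist
      (stem n ++ 1 :: 0 :: cycleWord k) := by
  obtain ⟨R, hR, -, -, h⟩ := exists_stem_append_sublist_iff h (1 :: 0 :: cycleWord k)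
  rw [h]
  exact (((replicate_sublist_cycleWord k).cons_cons 0).cons_cons 1).trans
    (List.sublist_append_right _ _)

end cycleWord

/-- Only a subword `w₁ ++ x :: y :: w₂` using both swapped letters is at issue. If `w₁` has at most
one letter, `w₁ ++ [x]` fits into `p`; otherwise `w₂` has fewer than `k` letters, and `y :: w₂` fits
into `E`. -/
theorem sublist_swap {α : Type*} {p E w : List α} {x y : α} {k : ℕ}
    (hp : ∀ c ∈ p, [c, x].Sublist p) (hx : x ∈ p)
    (hE : ∀ w : List α, w.Sublist E → w.length < k → (y :: w).Sublist E)
    (hw : w.length ≤ k + 3) (h : w.Sublist (p ++ x :: y :: E)) :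
    w.Sublist (p ++ y :: x :: E) := by
  obtain ⟨w₁, w₂, rfl, h₁, h₂⟩ := List.sublist_append_iff.1 h
  rw [List.length_append] at hw
  rcases List.sublist_cons_iff.1 h₂ with h₃ | ⟨w₂, rfl, h₃⟩
  · exact h₁.append (h₃.trans ((List.sublist_cons_self x E).cons_cons y))
  rcases List.sublist_cons_iff.1 h₃ with h₄ | ⟨w₂, rfl, h₄⟩
  · exact h₁.append ((h₄.cons_cons x).cons y)
  have early : ∀ {w₁ : List α}, (w₁ ++ [x]).Sublist p →
      (w₁ ++ x :: y :: w₂).Sublist (p ++ y :: x :: E) := by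
    intro w₁ h
    rw [List.append_cons]
    exact h.append ((h₄.trans (List.sublist_cons_self x E)).cons_cons y)
  match w₁ with
  | [] => exact early (List.singleton_sublist.2 hx)
  | [c] => exact early (hp c (h₁.subset (by simp)))
  | _ :: _ :: w₁ =>
    refine h₁.append (((hE w₂ h₄ ?_).cons_cons x).cons y)
    simp only [List.length_cons] at hw
    omega

/-- Every letter of the stem already occurs before its second `0, 1`. -/
theorem pair_sublist_stem {n c x : ℕ} (hc : c ∈ stem n) (hx : x = 0 ∨ x = 1) :
    [c, x].Sublist (stem n) := by
  have hc' : c ∈ 0 :: 1 :: alternation (List.range n) := by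
    revert hc
    simp only [stem, List.mem_append, List.mem_cons, mem_alternation, List.mem_map]
    rintro (h | h | h | h | h | ⟨j, hj, rfl⟩)
    · exact Or.inl h
    · exact Or.inr (Or.inl h)
    · exact Or.inr (Or.inr h)
    · exact Or.inl h
    · exact Or.inr (Or.inl h)
    · exact Or.inr (Or.inr ⟨j, hj, Or.inl rfl⟩)
  exact mem_sublist_append_of_mem hc' (List.singleton_sublist.2 (by
    rcases hx with rfl | rfl <;> simp))

theorem simonEquiv_critical (n k : ℕ) :
    SimonEquiv (k + 3) (stem n ++ 0 :: 1 :: cycleWord k) (stem n ++ 1 :: 0 :: cycleWord k) := by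
  have hE : ∀ y < 3, ∀ w : List ℕ, w.Sublist (cycleWord k) → w.length < k →
      (y :: w).Sublist (cycleWord k) := by
    intro y hy w hw hk
    refine sublist_cycleWord (fun c hc => ?_) hk
    rcases List.mem_cons.1 hc with rfl | hc
    exacts [hy, lt_of_mem_cycleWord (hw.subset hc)]
  intro w hw
  constructor
  · exact sublist_swap (fun c hc => pair_sublist_stem hc (Or.inl rfl)) (by simp [stem])
      (hE 1 (by omega)) hw
  · exact sublist_swap (fun c hc => pair_sublist_stem hc (Or.inr rfl)) (by simp [stem])
      (hE 0 (by omega)) hw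

/-! ### The invariant and the failure of finite bases -/

/-- The lists that are equivalent to `stem n ++ 0 :: 1 :: cycleWord k` and avoid the scattered
subwords that tell this word from `stem n ++ 1 :: 0 :: cycleWord k`. -/
def AvoidsCritical (n k : ℕ) (l : List ℕ) : Prop :=
  SimonEquiv (k + 3) l (stem n ++ 0 :: 1 :: cycleWord k) ∧
    ∀ i < n, ¬ (linearLetter i :: blockLetter i :: 1 :: 0 :: List.replicate k 2).Sublist l

theorem AvoidsCritical.flatMap {α : Type*} {a b : List α} {Θ : α → List ℕ} {n k : ℕ} (hk : 0 < k)
    (hab : SimonEquiv (k + 3) a b) (hn : a.length < n) (ha : AvoidsCritical n k (a.flatMap Θ)) :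
    AvoidsCritical n k (b.flatMap Θ) := by
  have hE : ∀ c ∈ 0 :: 1 :: cycleWord k, c < 3 := by
    simp only [List.mem_cons]
    rintro c (rfl | rfl | h)
    exacts [by omega, by omega, lt_of_mem_cycleWord h]
  obtain ⟨h, ha⟩ := ha
  have no : ∀ {w : List ℕ}, ¬ w.Sublist (stem n ++ 0 :: 1 :: cycleWord k) → w.length ≤ 4 →
      ¬ w.Sublist (a.flatMap Θ) := fun hw hl hw' => hw ((h _ (by omega)).1 hw')
  refine ⟨(hab.flatMap Θ).symm.trans h,
    not_sublist_flatMap_of_simonEquiv (m := k + 3) (fun i => ?_) (by omega) (by simp) hab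
    (fun i hi => (h _ (by simp)).2 (linear_block_sublist hi))
    (fun i hi => no (not_linear_linear_sublist hE hi) (by simp))
    (fun i hi => no (not_linear_block_block_sublist hE hi) (by simp))
    (fun i hi => no (not_block_block_linear_sublist hE hi) (by simp))
    (fun i j hij hj => no (not_block_linear_block_sublist hE hij hj) (by simp))
    (fun i j hi hj => no (not_linear_block_one_block_sublist hE hj) (by simp)) hn ha⟩
  simp only [blockLetter]
  omega

theorem AvoidsCritical.syntacticEquiv {a b : List ℕ} {Θ : ℕ → List ℕ} {n k : ℕ} (hk : 0 < k)
    (hab : SimonEquiv (k + 3) a b) (ha : a.length + 2 < n) (hb : b.length + 2 < n) :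
    SyntacticEquiv (AvoidsCritical n k) (a.flatMap Θ) (b.flatMap Θ) := by
  intro c d
  -- The context `c`, `d` is absorbed into the substitution through two fresh letters, which
  -- accounts for the `+ 2` in the length bounds.
  let Θ' : ℕ ⊕ Bool → List ℕ := Sum.elim Θ fun e => if e then d else c
  let ext : List ℕ → List (ℕ ⊕ Bool) := fun l =>
    [Sum.inr false] ++ l.flatMap (fun i => [Sum.inl i]) ++ [Sum.inr true]
  have hext : ∀ l, (ext l).flatMap Θ' = c ++ l.flatMap Θ ++ d := fun l => by
    simp [ext, Θ', List.flatMap_assoc]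
  have hlen : ∀ l, (ext l).length = l.length + 2 := fun l => by simp [ext]
  have hab' : SimonEquiv (k + 3) (ext a) (ext b) :=
    ((SimonEquiv.refl _).append (hab.flatMap _)).append (SimonEquiv.refl _)
  rw [← hext, ← hext]
  exact ⟨AvoidsCritical.flatMap hk hab' (by rwa [hlen]),
    AvoidsCritical.flatMap hk hab'.symm (by rwa [hlen])⟩

/-- A semigroup whose identities are exactly the pairs of `m`-equivalent words is non-finitely
based for `4 ≤ m`. -/
theorem not_finitelyBased_of_satisfies_iff {S : Type*} [Semigroup S] {m : ℕ} (hm : 4 ≤ m)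
    (hS : ∀ u v : Word, Satisfies S u v ↔ SimonEquiv m (letters u) (letters v)) :
    ¬ FinitelyBased S := by
  rintro ⟨B, hfin, hB, hder⟩
  obtain ⟨k, rfl⟩ := Nat.exists_eq_add_of_le' (show 3 ≤ m by omega)
  obtain ⟨N, hN⟩ :=
    (hfin.image fun p : Word × Word => (letters p.1).length + (letters p.2).length).bddAbove
  -- Each side of an identity in `B`, with two context letters added, is then strictly shorter than
  -- `n`.
  let n := N + 3
  have key := Derivable.syntacticEquiv (B := B) (P := AvoidsCritical n k) (by
      intro p hp σ
      have : (letters p.1).length + (letters p.2).length ≤ N := hN (Set.mem_image_of_mem _ hp)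
      rw [letters_lift, letters_lift]
      exact AvoidsCritical.syntacticEquiv (by omega) ((hS _ _).1 (hB p hp)) (by omega) (by omega))
    (hder ⟨0, (stem n ++ 0 :: 1 :: cycleWord k).tail⟩ ⟨0, (stem n ++ 1 :: 0 :: cycleWord k).tail⟩
      ((hS _ _).2 (simonEquiv_critical n k))) [] []
  rw [List.append_nil, List.append_nil, List.nil_append, List.nil_append] at key
  exact (key.1 ⟨SimonEquiv.refl _, fun i hi => not_critical_sublist hi (by omega)⟩).2 0
    (by omega) (critical_sublist k (by omega))

/-! ### Reflexive relations satisfy the identities -/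

theorem Satisfies.of_injective {S T : Type*} [Semigroup S] [Semigroup T] {u v : Word}
    (h : Satisfies T u v) (φ : S →ₙ* T) (hφ : Function.Injective φ) : Satisfies S u v := by
  intro f
  have hcomp : ∀ w : Word, φ (FreeSemigroup.lift f w) = FreeSemigroup.lift (φ ∘ f) w := by
    intro w
    induction w using FreeSemigroup.recOnMul with
    | ih1 x => simp
    | ih2 x y h₁ h₂ => rw [map_mul, map_mul, map_mul, h₁, h₂]
  exact hφ (by rw [hcomp, hcomp, h])

namespace ReflexiveRel

variable {X : Type*}

theorem mem_mul {R S : ReflexiveRel X} {a b : X} :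
    (a, b) ∈ (R * S).1 ↔ ∃ c, (a, c) ∈ R.1 ∧ (c, b) ∈ S.1 := Iff.rfl

/-- Reflexivity lets a path stay in place at each omitted letter. -/
theorem mem_prod_of_sublist {f : ℕ → ReflexiveRel X} {w l : List ℕ} (h : w.Sublist l) :
    ∀ {a b : X}, (a, b) ∈ (w.map f).prod.1 → (a, b) ∈ (l.map f).prod.1 := by
  induction h with
  | slnil => exact id
  | cons s _ ih =>
    intro a b hab
    rw [List.map_cons, List.prod_cons, mem_mul]
    exact ⟨a, (f s).2 a, ih hab⟩
  | cons_cons s _ ih =>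
    intro a b hab
    rw [List.map_cons, List.prod_cons, mem_mul] at hab ⊢
    obtain ⟨c, hac, hcb⟩ := hab
    exact ⟨c, hac, ih hcb⟩

theorem exists_short_sublist {m : ℕ} [Finite X] (hX : Nat.card X ≤ m + 1)
    {f : ℕ → ReflexiveRel X} {a b : X} (l : List ℕ) (h : (a, b) ∈ (l.map f).prod.1) :
    ∃ w : List ℕ, w.Sublist l ∧ w.length ≤ m ∧ (a, b) ∈ (w.map f).prod.1 := by
  by_cases hl : l.length ≤ m
  · exact ⟨l, List.Sublist.refl l, hl, h⟩
  have split : ∀ i : Fin (l.length + 1), ∃ c, (a, c) ∈ ((l.take i).map f).prod.1 ∧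
      (c, b) ∈ ((l.drop i).map f).prod.1 := by
    intro i
    rwa [← mem_mul, ← List.prod_append, ← List.map_append, List.take_append_drop]
  choose c hac hcb using split
  have := Fintype.ofFinite X
  -- A path with more than `m` steps repeats one of the at most `m + 1` points; the letters between
  -- the two visits can be deleted.
  obtain ⟨i, j, hij, hc⟩ : ∃ i j : Fin (l.length + 1), i < j ∧ c i = c j := by
    obtain ⟨i, j, hne, hc⟩ := Fintype.exists_ne_map_eq_of_card_lt c (by
      rw [Nat.card_eq_fintype_card] at hX
      rw [Fintype.card_fin]
      omega)
    rcases lt_or_gt_of_ne hne with h' | h'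
    exacts [⟨i, j, h', hc⟩, ⟨j, i, h', hc.symm⟩]
  have hsub : (l.take i ++ l.drop j).Sublist l := by
    conv_rhs => rw [← List.take_append_drop i l]
    exact (List.Sublist.refl _).append (List.drop_sublist_drop_left l hij.le)
  have hlen : (l.take i ++ l.drop j).length < l.length := by
    rw [List.length_append, List.length_take, List.length_drop]
    have := i.2
    have := j.2
    have : (i : ℕ) < j := hij
    omega
  obtain ⟨w, hw, hwm, hab⟩ := exists_short_sublist hX (l.take i ++ l.drop j) (by
    rw [List.map_append, List.prod_append, mem_mul]
    exact ⟨c i, hac i, hc ▸ hcb j⟩)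
  exact ⟨w, hw.trans hsub, hwm, hab⟩
termination_by l.length

theorem satisfies_of_simonEquiv {m : ℕ} [Finite X] (hX : Nat.card X ≤ m + 1) {u v : Word}
    (h : SimonEquiv m (letters u) (letters v)) : Satisfies (ReflexiveRel X) u v := by
  intro f
  rw [lift_eq_prod, lift_eq_prod]
  refine Subtype.ext (Set.ext fun p => ⟨fun hp => ?_, fun hp => ?_⟩) <;>
    obtain ⟨w, hw, hwm, hp'⟩ := exists_short_sublist hX _ hp
  · exact mem_prod_of_sublist ((h w hwm).1 hw) hp'
  · exact mem_prod_of_sublist ((h w hwm).2 hw) hp'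

/-- Reflexive relations are transported along an equivalence. -/
def congrHom {Y : Type*} (e : X ≃ Y) : ReflexiveRel X →ₙ* ReflexiveRel Y where
  toFun R := ⟨{p | (e.symm p.1, e.symm p.2) ∈ R.1}, fun x => R.2 (e.symm x)⟩
  map_mul' _ _ := Subtype.ext <| Set.ext fun _ => e.symm.surjective.exists

theorem congrHom_injective {Y : Type*} (e : X ≃ Y) : Function.Injective (congrHom e) := by
  intro R S h
  refine Subtype.ext (Set.ext fun p => ?_)
  have := Set.ext_iff.1 (congrArg Subtype.val h) (e p.1, e p.2)
  change (e.symm (e p.1), e.symm (e p.2)) ∈ R.1 ↔ (e.symm (e p.1), e.symm (e p.2)) ∈ S.1 at this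
  rwa [e.symm_apply_apply, e.symm_apply_apply] at this

end ReflexiveRel

/-! ### Embeddings between the three monoids -/

/-- An order preserving extensive map, viewed as a reflexive relation. -/
def extensiveMapsHom (C : Type*) [LinearOrder C] : extensiveMaps C →ₙ* ReflexiveRel C where
  toFun f := ⟨{p | p.2 ≤ p.1 ∧ p.1 ≤ f.1 p.2}, fun x => ⟨le_refl x, f.2 x⟩⟩
  map_mul' f g := Subtype.ext <| Set.ext fun ⟨a, b⟩ => by
    change b ≤ a ∧ a ≤ f.1 (g.1 b) ↔ ∃ c, (c ≤ a ∧ a ≤ f.1 c) ∧ (b ≤ c ∧ c ≤ g.1 b)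
    constructor
    · rintro ⟨hba, ha⟩
      rcases le_total a (g.1 b) with h | h
      · exact ⟨a, ⟨le_refl a, f.2 a⟩, hba, h⟩
      · exact ⟨g.1 b, ⟨h, ha⟩, g.2 b, le_refl _⟩
    · rintro ⟨c, ⟨hca, hac⟩, hbc, hcb⟩
      exact ⟨hbc.trans hca, hac.trans (f.1.monotone hcb)⟩

/-- The value `f b` is recovered as the largest point related to `b`. -/
theorem extensiveMapsHom_injective (C : Type*) [LinearOrder C] :
    Function.Injective (extensiveMapsHom C) := by
  intro f g h
  have key : ∀ a b : C, (b ≤ a ∧ a ≤ f.1 b) ↔ (b ≤ a ∧ a ≤ g.1 b) := fun a b =>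
    Set.ext_iff.1 (congrArg Subtype.val h) (a, b)
  refine Subtype.ext (OrderHom.ext _ _ (funext fun b => le_antisymm ?_ ?_))
  · exact ((key _ b).1 ⟨f.2 b, le_refl _⟩).2
  · exact ((key _ b).2 ⟨g.2 b, le_refl _⟩).2

/-- Extensive maps are transported along an order isomorphism. -/
def extensiveMapsCongrHom {C D : Type*} [LinearOrder C] [LinearOrder D] (e : C ≃o D) :
    extensiveMaps C →ₙ* extensiveMaps D where
  toFun f := ⟨⟨fun x => e (f.1 (e.symm x)), fun _ _ h =>
    e.monotone (f.1.monotone (e.symm.monotone h))⟩, fun x => e.symm_apply_le.1 (f.2 (e.symm x))⟩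
  map_mul' f g := Subtype.ext <| OrderHom.ext _ _ <| funext fun x => by
    change e (f.1 (g.1 (e.symm x))) = e (f.1 (e.symm (e (g.1 (e.symm x)))))
    rw [e.symm_apply_apply]

theorem extensiveMapsCongrHom_injective {C D : Type*} [LinearOrder C] [LinearOrder D]
    (e : C ≃o D) : Function.Injective (extensiveMapsCongrHom e) := by
  intro f g h
  refine Subtype.ext (OrderHom.ext _ _ (funext fun x => e.injective ?_))
  have := DFunLike.congr_fun (congrArg Subtype.val h) (e x)
  change e (f.1 (e.symm (e x))) = e (g.1 (e.symm (e x))) at this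
  rwa [e.symm_apply_apply] at this

namespace BooleanSemiring

theorem zero_ne_one : (0 : BooleanSemiring) ≠ 1 := Bool.false_ne_true

theorem add_eq_one_iff {a b : BooleanSemiring} : a + b = 1 ↔ a = 1 ∨ b = 1 :=
  Bool.or_eq_true_iff (x := a) (y := b)

theorem mul_eq_one_iff {a b : BooleanSemiring} : a * b = 1 ↔ a = 1 ∧ b = 1 :=
  Bool.and_eq_true_iff (x := a) (y := b)

theorem sum_eq_one_iff {ι : Type*} (s : Finset ι) (f : ι → BooleanSemiring) :
    ∑ i ∈ s, f i = 1 ↔ ∃ i ∈ s, f i = 1 := by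
  classical
  induction s using Finset.induction_on with
  | empty => simp [zero_ne_one]
  | insert i s hi ih => rw [Finset.sum_insert hi, add_eq_one_iff, ih]; simp

theorem ext_one {a b : BooleanSemiring} (h : a = 1 ↔ b = 1) : a = b :=
  Bool.eq_iff_iff.2 h

end BooleanSemiring

/-- A unitriangular Boolean matrix, viewed as a reflexive relation. -/
def unitriangularHom (n : ℕ) : unitriangular n →ₙ* ReflexiveRel (Fin n) where
  toFun A := ⟨{p | A.1 p.1 p.2 = 1}, A.2.2⟩
  map_mul' A B := Subtype.ext <| Set.ext fun ⟨i, j⟩ => by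
    change (A.1 * B.1) i j = 1 ↔ ∃ k, A.1 i k = 1 ∧ B.1 k j = 1
    simp [Matrix.mul_apply, BooleanSemiring.sum_eq_one_iff, BooleanSemiring.mul_eq_one_iff]

theorem unitriangularHom_injective (n : ℕ) : Function.Injective (unitriangularHom n) := by
  intro A B h
  refine Subtype.ext (Matrix.ext fun i j => BooleanSemiring.ext_one ?_)
  exact Set.ext_iff.1 (congrArg Subtype.val h) (i, j)

theorem unitriangularHom_range {n : ℕ} {R : ReflexiveRel (Fin n)}
    (hR : ∀ i j, (i, j) ∈ R.1 → i ≤ j) : ∃ A, unitriangularHom n A = R := by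
  classical
  refine ⟨⟨Matrix.of fun i j => if (i, j) ∈ R.1 then 1 else 0, fun i j hij => ?_, fun i => ?_⟩,
    Subtype.ext (Set.ext fun ⟨i, j⟩ => ?_)⟩
  · exact if_neg fun h => absurd (hR i j h) (not_le.2 hij)
  · exact if_pos (R.2 i)
  · change (if (i, j) ∈ R.1 then (1 : BooleanSemiring) else 0) = 1 ↔ (i, j) ∈ R.1
    simp [BooleanSemiring.zero_ne_one]

theorem Satisfies.extensiveMaps_of_unitriangular {n : ℕ} {u v : Word}
    (h : Satisfies (unitriangular n) u v) : Satisfies (extensiveMaps (Fin n)) u v := by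
  -- The relation of an extensive map goes downwards; reversing the chain makes it upper triangular.
  let φ := (ReflexiveRel.congrHom Fin.revPerm).comp (extensiveMapsHom (Fin n))
  have hφ : ∀ f, ∃ A, unitriangularHom n A = φ f := fun f =>
    unitriangularHom_range fun i j hij => Fin.rev_le_rev.1 hij.1
  choose ψ hψ using hφ
  refine h.of_injective (⟨ψ, fun f g => unitriangularHom_injective n ?_⟩ : _ →ₙ* _)
    fun f g hfg => ?_
  · rw [map_mul, hψ, hψ, hψ, map_mul]
  · refine extensiveMapsHom_injective _ (ReflexiveRel.congrHom_injective Fin.revPerm ?_)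
    change φ f = φ g
    rw [← hψ, ← hψ]
    exact congrArg _ hfg

/-! ### Extensive maps detect short subwords -/

/-- The map that steps from `i` to `i + 1` when `c` is the letter of `w` at distance `i` from the
end. -/
def stepMap {m : ℕ} (w : List ℕ) (hw : w.length ≤ m) (c : ℕ) : extensiveMaps (Fin (m + 1)) :=
  ⟨⟨fun i => if h : i < w.length ∧ w.reverse[i.1]? = some c then ⟨i + 1, by omega⟩ else i, by
    intro i j hij
    dsimp only
    rcases hij.lt_or_eq with h | rfl
    · rw [Fin.le_def]
      rw [Fin.lt_def] at h
      split_ifs <;> (try simp only) <;> omega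
    · exact le_refl _⟩, by
    intro i
    change i ≤ dite _ _ _
    rw [Fin.le_def]
    split_ifs
    · exact Nat.le_succ _
    · exact le_refl _⟩

/-- In a composition the last letter acts first, so `0` climbs through `w` from its end: its image
is the length of the longest suffix of `w` that is a scattered subword of `l`. -/
theorem stepMap_prod_le_iff {m : ℕ} (w : List ℕ) (hw : w.length ≤ m) (l : List ℕ) (k d : ℕ)
    (hd : k + d = w.length) :
    k ≤ ((((l.map (stepMap w hw)).prod : extensiveMaps (Fin (m + 1))).1 0 : Fin (m + 1)) : ℕ) ↔
      (w.drop d).Sublist l := by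
  induction l generalizing k d with
  | nil =>
    change k ≤ 0 ↔ _
    rw [List.sublist_nil, List.drop_eq_nil_iff]
    omega
  | cons c l ih =>
    rw [List.map_cons, List.prod_cons]
    set i := ((l.map (stepMap w hw)).prod : extensiveMaps (Fin (m + 1))).1 0 with hi
    change k ≤ ((dite _ _ _ : Fin (m + 1)) : ℕ) ↔ _
    cases k with
    | zero => simp [List.drop_eq_nil_of_le (show w.length ≤ d by omega)]
    | succ k =>
      have hdw : d < w.length := by omega
      rw [List.drop_eq_getElem_cons hdw, List.sublist_cons_iff, ← List.drop_eq_getElem_cons hdw,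
        ← ih (k + 1) d hd]
      have hcons : (∃ r, w.drop d = c :: r ∧ r.Sublist l) ↔ w[d] = c ∧ k ≤ (i : ℕ) := by
        rw [ih k (d + 1) (by omega), List.drop_eq_getElem_cons hdw]
        constructor
        · rintro ⟨r, h, hr⟩
          rw [List.cons.injEq] at h
          exact ⟨h.1, h.2 ▸ hr⟩
        · rintro ⟨h, hr⟩
          exact ⟨_, by rw [h], hr⟩
      rw [hcons]
      -- The new letter matters only when exactly `k` letters have been matched; the next one needed
      -- is then `w[d]`.
      have hlast : (i : ℕ) = k → w.reverse[i.1]? = some w[d] := by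
        intro h
        rw [List.getElem?_reverse (by omega), show w.length - 1 - i.1 = d by omega,
          List.getElem?_eq_getElem hdw]
      split_ifs with h
      · constructor
        · intro hk
          rcases (Nat.le_of_succ_le_succ hk).eq_or_lt with hki | hki
          · rw [hlast hki.symm, Option.some.injEq] at h
            exact Or.inr ⟨h.2, hki.le⟩
          · exact Or.inl hki
        · rintro (hk | ⟨-, hk⟩)
          · exact Nat.le_succ_of_le hk
          · exact Nat.succ_le_succ hk
      · refine ⟨Or.inl, ?_⟩
        rintro (hk | ⟨hc, hk⟩)
        · exact hk
        · rcases hk.eq_or_lt with hki | hki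
          · exact absurd ⟨by omega, by rw [hlast hki.symm, hc]⟩ h
          · exact hki

theorem Satisfies.simonEquiv {m : ℕ} {u v : Word}
    (h : Satisfies (extensiveMaps (Fin (m + 1))) u v) :
    SimonEquiv m (letters u) (letters v) := by
  intro w hw
  have key := h (stepMap w hw)
  rw [lift_eq_prod, lift_eq_prod] at key
  have hu := stepMap_prod_le_iff w hw (letters u) w.length 0 rfl
  have hv := stepMap_prod_le_iff w hw (letters v) w.length 0 rfl
  rw [List.drop_zero] at hu hv
  rw [← hu, ← hv, key]

/-! ### The identities of the three monoids -/

theorem satisfies_reflexiveRel_iff {X : Type*} {m : ℕ} (hX : Nat.card X = m + 1) (u v : Word) :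
    Satisfies (ReflexiveRel X) u v ↔ SimonEquiv m (letters u) (letters v) := by
  have : Finite X := Nat.finite_of_card_ne_zero (by omega)
  refine ⟨fun h => ?_, ReflexiveRel.satisfies_of_simonEquiv hX.le⟩
  have hFin : Satisfies (ReflexiveRel (Fin (m + 1))) u v :=
    h.of_injective _ (ReflexiveRel.congrHom_injective (Finite.equivFinOfCardEq hX).symm)
  exact (hFin.of_injective _ (extensiveMapsHom_injective _)).simonEquiv

theorem satisfies_extensiveMaps_iff {C : Type*} [LinearOrder C] {m : ℕ}
    (hC : Nat.card C = m + 1) (u v : Word) :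
    Satisfies (extensiveMaps C) u v ↔ SimonEquiv m (letters u) (letters v) := by
  have : Finite C := Nat.finite_of_card_ne_zero (by omega)
  have := Fintype.ofFinite C
  refine ⟨fun h => ?_, fun h =>
    (ReflexiveRel.satisfies_of_simonEquiv hC.le h).of_injective _ (extensiveMapsHom_injective C)⟩
  rw [Nat.card_eq_fintype_card] at hC
  exact (h.of_injective _
    (extensiveMapsCongrHom_injective (Fintype.orderIsoFinOfCardEq C hC))).simonEquiv

theorem satisfies_unitriangular_iff {m : ℕ} (u v : Word) :
    Satisfies (unitriangular (m + 1)) u v ↔ SimonEquiv m (letters u) (letters v) :=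
  ⟨fun h => h.extensiveMaps_of_unitriangular.simonEquiv, fun h =>
    (ReflexiveRel.satisfies_of_simonEquiv (Nat.card_fin _).le h).of_injective _
      (unitriangularHom_injective _)⟩

end Straubing

theorem corollary6 (m : ℕ) (hm : 4 ≤ m) :
    (∀ (X : Type*), Nat.card X = m + 1 → ¬ Straubing.FinitelyBased (Straubing.ReflexiveRel X)) ∧
    ¬ Straubing.FinitelyBased (Straubing.unitriangular (m + 1)) ∧
    (∀ (C : Type*) [LinearOrder C], Nat.card C = m + 1 →
      ¬ Straubing.FinitelyBased (Straubing.extensiveMaps C)) :=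
  ⟨fun _ hX => Straubing.not_finitelyBased_of_satisfies_iff hm
      (Straubing.satisfies_reflexiveRel_iff hX),
    Straubing.not_finitelyBased_of_satisfies_iff hm Straubing.satisfies_unitriangular_iff,
    fun _ _ hC => Straubing.not_finitelyBased_of_satisfies_iff hm
      (Straubing.satisfies_extensiveMaps_iff hC)⟩
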